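/- Let $p$ be an odd prime and let $R$ be a ring with identity (not assumed commutative) of order $p^2$. Let $\mathbb H_3(R)$ be the Heisenberg group over $R$, that is, the set $R\times R\times R$ with the multiplication $$(c,b,a)(c',b',a')=(c+c'+ab',\,b+b',\,a+a'),$$ and let $\mathrm H^2(\mathbb H_3(R),\mathbb C^\times)$ be its Schur multiplier, the second cohomology group with coefficients in $\mathbb C^\times$ with trivial action. Then $R$ is isomorphic to one of the rings $\mathbb F_p[t]/(t^2)$, $\mathbb F_{p^2}$, $\mathbb Z/p\mathbb Z\times\mathbb Z/p\mathbb Z$, $\mathbb Z/p^2\mathbb Z$, and, as groups, $$\mathrm H^2\big(\mathbb H_3(R),\mathbb C^\times\big)\cong\begin{cases}(\mathbb Z/p\mathbb Z)^8 & \text{if } R\cong\mathbb F_p[t]/(t^2),\\ (\mathbb Z/p\mathbb Z)^8 & \text{if } R\cong\mathbb F_{p^2},\\ (\mathbb Z/p\mathbb Z)^8 & \text{if } R\cong\mathbb Z/p\mathbb Z\times\mathbb Z/p\mathbb Z,\\ (\mathbb Z/p^2\mathbb Z)^2 & \text{if } R\cong\mathbb Z/p^2\mathbb Z.\end{cases}$$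 -/

import Mathlib

universe u

/-- The underlying set `R × R × R` of the Heisenberg group `ℍ₃(R)`; its elements are the triples
`(c, b, a)`. -/
@[ext]
structure Heisenberg (R : Type u) where
  c : R
  b : R
  a : R

namespace Heisenberg

variable {R : Type u} [Ring R]

/-- The group law `(c, b, a) (c', b', a') = (c + c' + a b', b + b', a + a')`. -/
instance : Mul (Heisenberg R) where
  mul x y := ⟨x.c + y.c + x.a * y.b, x.b + y.b, x.a + y.a⟩

instance : One (Heisenberg R) where
  one := ⟨0, 0, 0⟩

instance : Inv (Heisenberg R) where
  inv x := ⟨-x.c + x.a * x.b, -x.b, -x.a⟩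

theorem mul_def (x y : Heisenberg R) :
    x * y = ⟨x.c + y.c + x.a * y.b, x.b + y.b, x.a + y.a⟩ := rfl

theorem one_def : (1 : Heisenberg R) = ⟨0, 0, 0⟩ := rfl

theorem inv_def (x : Heisenberg R) : x⁻¹ = ⟨-x.c + x.a * x.b, -x.b, -x.a⟩ := rfl

instance : Group (Heisenberg R) :=
  Group.ofLeftAxioms
    (fun x y z => by
      simp only [mul_def, Heisenberg.mk.injEq, mul_add, add_mul]
      refine ⟨?_, ?_, ?_⟩ <;> abel)
    (fun x => by simp [mul_def, one_def])
    (fun x => by simp [mul_def, one_def, inv_def])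

end Heisenberg

/-- The Schur multiplier `H²(G, ℂˣ)` of a group `G`: the second cohomology group of `G` with
coefficients in the multiplicative group `ℂˣ` (written additively), on which `G` acts trivially.
The base ring `ℤ` and the coefficient group are lifted to the universe of `G`, as Mathlib's group
cohomology requires; only the additive group underlying this module matters. -/
noncomputable abbrev SchurMultiplier (G : Type u) [Group G] : ModuleCat.{u} (ULift.{u} ℤ) :=
  groupCohomology.H2 (Rep.trivial (ULift.{u} ℤ) G (ULift.{u} (Additive ℂˣ)))

/-- The ring `𝔽_p[t]/(t²)`. -/
abbrev TruncatedPolynomialRing (p : ℕ) : Type :=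
  Polynomial (ZMod p) ⧸ Ideal.span {(Polynomial.X : Polynomial (ZMod p)) ^ 2}

/-! A two-cocycle `f` defines a central extension, and on commuting elements `f g h - f h g` is the
commutator of lifts: it is additive in each variable, invariant under conjugation and zero on
coboundaries. Let `R` be commutative with 2 invertible. Central elements are commutators, so they
pair trivially with each other; conjugation invariance forces the pairing of a central `c` with `b`
or `a` to depend only on `c * b` or `a * c`. It is therefore given by two homomorphisms `φ`, `ψ`
from `R` to the coefficients, and both are realized by explicit cocycles. Once these are subtracted,
the class is inflated from the abelian quotient `R × R` (`exists_inflation`). Since symmetric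
cocycles with divisible coefficients split, it is there half of an alternating pairing, that is, two
alternating forms `ω₁`, `ω₂` on `R` and a mixed biadditive form `β` (`exists_biadditive`). The only
relation is that the forms `χ (a * b)` become trivial (`normalForm_eq_zero`). With `D` the dual of
`R`, the multiplier is thus `D ⊕ D ⊕ Alt ⊕ Alt ⊕ Bil` modulo a copy of `D`. In characteristic `p`
the dimensions over `𝔽_p` are `2 + 2 + 1 + 1 + 4 - 2 = 8`. If the additive group is cyclic, `Alt`
vanishes and `Bil` is the copy of `D`, which leaves `D ⊕ D`. The rings of order `p ^ 2` are all
commutative, by their classification. -/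

/-! ### Two-cocycles with trivial action -/

/-- The commutator pairing of a two-cochain. It is meaningful on commuting pairs of elements. -/
def commPairing {G A : Type*} [AddCommGroup A] (f : G → G → A) (g h : G) : A := f g h - f h g

theorem commPairing_sub {G A : Type*} [AddCommGroup A] (f f' : G → G → A) (g h : G) :
    commPairing (f - f') g h = commPairing f g h - commPairing f' g h := by
  simp only [commPairing, Pi.sub_apply]
  abel

theorem commPairing_swap {G A : Type*} [AddCommGroup A] (f : G → G → A) (g h : G) :
    commPairing f g h = -commPairing f h g := by
  simp only [commPairing, neg_sub]

section Cochains

variable {G H A : Type*} [Group G] [Group H] [AddCommGroup A]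

/-- The two-cocycle condition for a function of two variables, with trivial action. -/
def IsTwoCocycle (f : G → G → A) : Prop :=
  ∀ g h k, f (g * h) k + f g h = f h k + f g (h * k)

/-- The two-coboundary condition for a function of two variables, with trivial action. -/
def IsTwoCoboundary (f : G → G → A) : Prop :=
  ∃ u : G → A, ∀ g h, f g h = u g + u h - u (g * h)

theorem IsTwoCoboundary.isTwoCocycle {f : G → G → A} (hf : IsTwoCoboundary f) :
    IsTwoCocycle f := by
  obtain ⟨u, hu⟩ := hf
  intro g h k
  simp only [hu, mul_assoc]
  abel

theorem IsTwoCocycle.add {f f' : G → G → A} (hf : IsTwoCocycle f) (hf' : IsTwoCocycle f') :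
    IsTwoCocycle (f + f') := by
  intro g h k
  simp only [Pi.add_apply]
  linear_combination (norm := abel) hf g h k + hf' g h k

theorem IsTwoCocycle.neg {f : G → G → A} (hf : IsTwoCocycle f) : IsTwoCocycle (-f) := by
  intro g h k
  simp only [Pi.neg_apply]
  linear_combination (norm := abel) -hf g h k

theorem IsTwoCocycle.sub {f f' : G → G → A} (hf : IsTwoCocycle f) (hf' : IsTwoCocycle f') :
    IsTwoCocycle (f - f') :=
  sub_eq_add_neg f f' ▸ hf.add hf'.neg

theorem IsTwoCoboundary.add {f f' : G → G → A} (hf : IsTwoCoboundary f)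
    (hf' : IsTwoCoboundary f') : IsTwoCoboundary (f + f') := by
  obtain ⟨u, hu⟩ := hf
  obtain ⟨u', hu'⟩ := hf'
  refine ⟨u + u', fun g h => ?_⟩
  simp only [Pi.add_apply, hu, hu']
  abel

theorem IsTwoCoboundary.neg {f : G → G → A} (hf : IsTwoCoboundary f) :
    IsTwoCoboundary (-f) := by
  obtain ⟨u, hu⟩ := hf
  refine ⟨-u, fun g h => ?_⟩
  simp only [Pi.neg_apply, hu]
  abel

theorem IsTwoCocycle.comp {f : G → G → A} (hf : IsTwoCocycle f) (φ : H →* G) :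
    IsTwoCocycle fun x y => f (φ x) (φ y) := fun x y z => by
  simpa only [map_mul] using hf (φ x) (φ y) (φ z)

theorem IsTwoCoboundary.comp {f : G → G → A} (hf : IsTwoCoboundary f) (φ : H →* G) :
    IsTwoCoboundary fun x y => f (φ x) (φ y) := by
  obtain ⟨u, hu⟩ := hf
  exact ⟨fun x => u (φ x), fun x y => by simp only [hu, map_mul]⟩

theorem IsTwoCocycle.map_one_left {f : G → G → A} (hf : IsTwoCocycle f) (g : G) :
    f 1 g = f 1 1 := by
  have := hf 1 1 g
  simp only [one_mul] at this
  linear_combination (norm := abel) -this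

theorem IsTwoCoboundary.commPairing_eq_zero {f : G → G → A} (hf : IsTwoCoboundary f) {g h : G}
    (hgh : g * h = h * g) : commPairing f g h = 0 := by
  obtain ⟨u, hu⟩ := hf
  simp only [commPairing, hu, hgh]
  abel

/-- Commutators of lifts of commuting elements lie in the central subgroup `A`, so they multiply. It
is enough that `g` commutes with `h` and with `k`; these two need not commute with each other. -/
theorem IsTwoCocycle.commPairing_mul_right {f : G → G → A} (hf : IsTwoCocycle f) {g h k : G}
    (hgh : g * h = h * g) (hgk : g * k = k * g) :
    commPairing f g (h * k) = commPairing f g h + commPairing f g k := by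
  have h₁ := hf g h k
  have h₂ := hf h g k
  have h₃ := hf h k g
  rw [hgh] at h₁
  rw [hgk] at h₂
  simp only [commPairing]
  linear_combination (norm := abel) -h₁ + h₂ - h₃

theorem IsTwoCocycle.commPairing_mul_left {f : G → G → A} (hf : IsTwoCocycle f) {g h k : G}
    (hgk : g * k = k * g) (hhk : h * k = k * h) :
    commPairing f (g * h) k = commPairing f g k + commPairing f h k := by
  rw [commPairing_swap, hf.commPairing_mul_right hgk.symm hhk.symm, neg_add,
    ← commPairing_swap, ← commPairing_swap]

/-- The commutator pairing is invariant under conjugation: here `g'` and `h'` are the conjugates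
of `g` and `h` by `x`. -/
theorem IsTwoCocycle.commPairing_conj {f : G → G → A} (hf : IsTwoCocycle f) {g h g' h' x : G}
    (hgh : g * h = h * g) (hg : x * g = g' * x) (hh : x * h = h' * x) :
    commPairing f g' h' = commPairing f g h := by
  have hgh' : g' * h' = h' * g' := by
    rw [← mul_left_inj x, mul_assoc, ← hh, ← mul_assoc, ← hg, mul_assoc, hgh, ← mul_assoc, hh,
      mul_assoc, hg, mul_assoc]
  -- These identities move `x` through `x * g * h`, then `g' * x * h`, then `g' * h' * x`, and
  -- likewise with the two factors exchanged.
  have h₁ := hf x g h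
  have h₂ := hf x h g
  have h₃ := hf g' x h
  have h₄ := hf h' x g
  have h₅ := hf g' h' x
  have h₆ := hf h' g' x
  rw [hgh, hg] at h₁
  rw [hh] at h₂
  rw [hh] at h₃
  rw [hg] at h₄
  rw [hgh'] at h₅
  simp only [commPairing]
  linear_combination (norm := abel) h₁ - h₂ + h₅ - h₆ + h₄ - h₃

/-- A biadditive map gives a two-cocycle. -/
theorem IsTwoCocycle.of_biadditive {f : G → G → A} (hl : ∀ g h k, f (g * h) k = f g k + f h k)
    (hr : ∀ g h k, f g (h * k) = f g h + f g k) : IsTwoCocycle f := fun g h k => by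
  rw [hl, hr]
  abel

end Cochains

/-! ### Splitting of abelian extensions with divisible kernel -/

section Symmetric

variable {V A : Type*} [CommGroup V] [AddCommGroup A]

/-- The abelian extension defined by a symmetric two-cocycle. -/
structure SymmExtension (f : V → V → A) where
  fst : A
  snd : V

namespace SymmExtension

/-- The group structure on the extension defined by a symmetric two-cocycle. -/
@[reducible]
def addCommGroup {f : V → V → A} (hf : IsTwoCocycle f) (hs : ∀ v w, f v w = f w v) :
    AddCommGroup (SymmExtension f) :=
  letI : Add (SymmExtension f) := ⟨fun x y => ⟨x.1 + y.1 + f x.2 y.2, x.2 * y.2⟩⟩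
  -- The cocycle is not normalized: `f 1 v = f 1 1` may be nonzero, and the neutral element has to
  -- compensate for it.
  letI : Zero (SymmExtension f) := ⟨⟨-f 1 1, 1⟩⟩
  letI : Neg (SymmExtension f) := ⟨fun x => ⟨-x.1 - f x.2⁻¹ x.2 - f 1 1, x.2⁻¹⟩⟩
  have add_def (x y : SymmExtension f) : x + y = ⟨x.1 + y.1 + f x.2 y.2, x.2 * y.2⟩ := rfl
  have zero_def : (0 : SymmExtension f) = ⟨-f 1 1, 1⟩ := rfl
  have neg_def (x : SymmExtension f) : -x = ⟨-x.1 - f x.2⁻¹ x.2 - f 1 1, x.2⁻¹⟩ := rfl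
  { AddGroup.ofLeftAxioms
      (fun x y z => by
        simp only [add_def, mul_assoc, mk.injEq, and_true]
        linear_combination (norm := abel) hf x.2 y.2 z.2)
      (fun x => by
        simp only [add_def, zero_def, one_mul, hf.map_one_left]
        congr 1
        abel)
      (fun x => by
        simp only [add_def, zero_def, inv_mul_cancel, mk.injEq, and_true]
        abel) with
    add_comm := fun x y => by
      simp only [add_def, add_comm x.1, hs x.2, mul_comm x.2] }

end SymmExtension

/-- A symmetric two-cocycle of an abelian group with divisible coefficients is a coboundary. -/
theorem IsTwoCocycle.isTwoCoboundary_of_symm [DivisibleBy A ℤ] {f : V → V → A}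
    (hf : IsTwoCocycle f) (hs : ∀ v w, f v w = f w v) : IsTwoCoboundary f := by
  let := SymmExtension.addCommGroup hf hs
  have add_def (x y : SymmExtension f) : x + y = ⟨x.1 + y.1 + f x.2 y.2, x.2 * y.2⟩ := rfl
  let i : A →+ SymmExtension f := AddMonoidHom.mk' (fun a => ⟨a - f 1 1, 1⟩) fun a b => by
    simp only [add_def, mul_one]
    congr 1
    abel
  have hi : Function.Injective i := fun a b hab => by
    exact sub_left_injective (congrArg SymmExtension.fst hab)
  -- Divisible groups are injective, so the inclusion of `A` has a retraction `r`; its values on the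
  -- section `v ↦ (0, v)` form the required cochain.
  obtain ⟨r, hr⟩ := (Module.Baer.of_divisible A).extension_property_addMonoidHom i hi
    (AddMonoidHom.id A)
  have hri (a : A) : r ⟨a - f 1 1, 1⟩ = a := DFunLike.congr_fun hr a
  refine ⟨fun v => r ⟨0, v⟩, fun v w => ?_⟩
  have key : (⟨0, v⟩ + ⟨0, w⟩ : SymmExtension f) = ⟨f v w - f 1 1, 1⟩ + ⟨0, v * w⟩ := by
    simp only [add_def, one_mul, hf.map_one_left]
    congr 1
    abel
  have := congrArg r key
  rw [map_add, map_add, hri] at this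
  rw [this]
  abel

end Symmetric

/-- On an abelian group in which every element has a square root, depending multiplicatively on
it, every two-cocycle with divisible coefficients is cohomologous to half of its commutator
pairing. -/
theorem IsTwoCocycle.isTwoCoboundary_sub_half {V A : Type*} [CommGroup V] [AddCommGroup A]
    [DivisibleBy A ℤ] {f : V → V → A} (hf : IsTwoCocycle f) (η : V →* V)
    (hη : ∀ v, η v * η v = v) : IsTwoCoboundary (f - fun v w => commPairing f (η v) w) := by
  have hl (g h k : V) : commPairing f (g * h) k = commPairing f g k + commPairing f h k :=
    hf.commPairing_mul_left (mul_comm _ _) (mul_comm _ _)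
  have hr (g h k : V) : commPairing f g (h * k) = commPairing f g h + commPairing f g k :=
    hf.commPairing_mul_right (mul_comm _ _) (mul_comm _ _)
  refine (hf.sub (.of_biadditive (fun g h k => ?_) fun g h k => ?_)).isTwoCoboundary_of_symm
    fun v w => ?_
  · rw [map_mul, hl]
  · rw [hr]
  -- Exchanging `v` and `w` changes `f` by the full pairing and the antisymmetric half pairing by
  -- twice itself, so the difference is symmetric. Halving both arguments makes the two orders
  -- comparable.
  · have h₁ : commPairing f (η v) w = commPairing f (η v) (η w) + commPairing f (η v) (η w) := by
      rw [← hr, hη]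
    have h₂ : commPairing f v w = commPairing f (η v) w + commPairing f (η v) w := by
      rw [← hl, hη]
    have h₃ : commPairing f (η w) v = commPairing f (η w) (η v) + commPairing f (η w) (η v) := by
      rw [← hr, hη]
    have h₄ : commPairing f (η w) (η v) = -commPairing f (η v) (η w) := commPairing_swap _ _ _
    simp only [Pi.sub_apply]
    have h₅ : f v w - f w v = commPairing f v w := rfl
    linear_combination (norm := abel) h₅ + h₂ + h₁ + h₃ + 2 • h₄

/-! ### Normal form of two-cocycles of the Heisenberg group -/

namespace Heisenberg

section Cocycles

variable {R A : Type*} [CommRing R] [AddCommGroup A]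

/-- The homomorphism of the Heisenberg group onto its quotient by the centre. -/
def toProd : Heisenberg R →* Multiplicative (R × R) where
  toFun g := .ofAdd (g.b, g.a)
  map_one' := rfl
  map_mul' _ _ := rfl

/-- The two-cocycle with commutator pairing `φ (c * b)` between the elements `(c, 0, 0)` and
`(0, b, 0)`. -/
def leftCocycle [Invertible (2 : R)] (φ : R →+ A) (g h : Heisenberg R) : A :=
  φ (g.c * h.b + ⅟2 * g.a * h.b ^ 2)

/-- The two-cocycle with commutator pairing `ψ (a * c)` between the elements `(0, 0, a)` and
`(c, 0, 0)`. -/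
def rightCocycle [Invertible (2 : R)] (ψ : R →+ A) (g h : Heisenberg R) : A :=
  ψ (g.a * h.c + ⅟2 * g.a ^ 2 * h.b)

/-- The two-cocycle inflated from the biadditive map on `R × R` with the given components. -/
def biadditiveCocycle (ω₁ ω₂ β : R →+ R →+ A) (g h : Heisenberg R) : A :=
  ω₁ g.b h.b + ω₂ g.a h.a + β g.a h.b

/-- The term `g.c * h.b` alone violates the cocycle identity by `g.a * h.b * k.b`, because of the
product in the central coordinate; the quadratic term has the opposite defect. -/
theorem isTwoCocycle_leftCocycle [Invertible (2 : R)] (φ : R →+ A) :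
    IsTwoCocycle (leftCocycle φ) := fun g h k => by
  simp only [leftCocycle, mul_def, ← map_add]
  congr 1
  linear_combination -(g.a * h.b * k.b) * invOf_mul_self' (2 : R)

theorem isTwoCocycle_rightCocycle [Invertible (2 : R)] (ψ : R →+ A) :
    IsTwoCocycle (rightCocycle ψ) := fun g h k => by
  simp only [rightCocycle, mul_def, ← map_add]
  congr 1
  linear_combination (g.a * h.a * k.b) * invOf_mul_self' (2 : R)

theorem isTwoCocycle_biadditiveCocycle (ω₁ ω₂ β : R →+ R →+ A) :
    IsTwoCocycle (biadditiveCocycle ω₁ ω₂ β) :=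
  .of_biadditive
    (fun g h k => by
      simp only [biadditiveCocycle, mul_def, map_add, AddMonoidHom.add_apply]
      abel)
    (fun g h k => by
      simp only [biadditiveCocycle, mul_def, map_add]
      abel)

/-- Pairing with a central element is a homomorphism to an abelian group, and `(y, 0, 0)` is the
commutator of `(0, 0, 1)` and `(0, y, 0)`. -/
theorem commPairing_center_center {f : Heisenberg R → Heisenberg R → A} (hf : IsTwoCocycle f)
    (x y : R) : commPairing f ⟨x, 0, 0⟩ ⟨y, 0, 0⟩ = 0 := by
  have h := hf.commPairing_conj (g := ⟨x, 0, 0⟩) (h := ⟨0, y, 0⟩) (g' := ⟨x, 0, 0⟩)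
    (h' := ⟨y, 0, 0⟩ * ⟨0, y, 0⟩) (x := ⟨0, 0, 1⟩)
    (by simp [mul_def]) (by simp [mul_def]) (by simp [mul_def])
  rw [hf.commPairing_mul_right (by simp [mul_def, add_comm]) (by simp [mul_def])] at h
  simpa using h

/-- Conjugation by `(0, 0, c)` multiplies `(0, b, 0)` and `(0, 1, 0)` by the central elements `c *
b` and `c`. Invariance of their pairing makes the two extra terms cancel. -/
theorem commPairing_center_b {f : Heisenberg R → Heisenberg R → A} (hf : IsTwoCocycle f)
    (c b : R) : commPairing f ⟨c, 0, 0⟩ ⟨0, b, 0⟩ =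
      commPairing f ⟨c * b, 0, 0⟩ ⟨0, 1, 0⟩ := by
  have h := hf.commPairing_conj (g := ⟨0, b, 0⟩) (h := ⟨0, 1, 0⟩)
    (g' := ⟨c * b, 0, 0⟩ * ⟨0, b, 0⟩) (h' := ⟨c, 0, 0⟩ * ⟨0, 1, 0⟩) (x := ⟨0, 0, c⟩)
    (by simp [mul_def, add_comm]) (by simp [mul_def]) (by simp [mul_def])
  rw [hf.commPairing_mul_right (by simp [mul_def, add_comm]) (by simp [mul_def, add_comm]),
    hf.commPairing_mul_left (by simp [mul_def, add_comm]) (by simp [mul_def, add_comm]),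
    hf.commPairing_mul_left (by simp [mul_def, add_comm]) (by simp [mul_def, add_comm]),
    commPairing_center_center hf, commPairing_swap f ⟨0, b, 0⟩ ⟨c, 0, 0⟩] at h
  linear_combination (norm := abel) -h

theorem commPairing_a_center {f : Heisenberg R → Heisenberg R → A} (hf : IsTwoCocycle f)
    (a c : R) : commPairing f ⟨0, 0, a⟩ ⟨c, 0, 0⟩ =
      commPairing f ⟨0, 0, 1⟩ ⟨a * c, 0, 0⟩ := by
  have h := hf.commPairing_conj (g := ⟨0, 0, a⟩) (h := ⟨0, 0, 1⟩)
    (g' := ⟨a * c, 0, 0⟩ * ⟨0, 0, a⟩) (h' := ⟨c, 0, 0⟩ * ⟨0, 0, 1⟩) (x := ⟨0, -c, 0⟩)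
    (by simp [mul_def, add_comm]) (by simp [mul_def]) (by simp [mul_def])
  rw [hf.commPairing_mul_right (by simp [mul_def, add_comm]) (by simp [mul_def, add_comm]),
    hf.commPairing_mul_left (by simp [mul_def, add_comm]) (by simp [mul_def, add_comm]),
    hf.commPairing_mul_left (by simp [mul_def, add_comm]) (by simp [mul_def, add_comm]),
    commPairing_center_center hf, commPairing_swap f ⟨a * c, 0, 0⟩] at h
  linear_combination (norm := abel) h

/-- A two-cocycle whose commutator pairing with the centre vanishes is cohomologous to one inflated
from the quotient by the centre. -/
theorem exists_inflation [DivisibleBy A ℤ] {f : Heisenberg R → Heisenberg R → A}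
    (hf : IsTwoCocycle f) (hc : ∀ c g, commPairing f ⟨c, 0, 0⟩ g = 0) :
    ∃ F : Multiplicative (R × R) → Multiplicative (R × R) → A, IsTwoCocycle F ∧
      IsTwoCoboundary (f - fun g h => F (toProd g) (toProd h)) := by
  let ι : Multiplicative R →* Heisenberg R :=
    { toFun c := ⟨c.toAdd, 0, 0⟩
      map_one' := rfl
      map_mul' x y := by simp [mul_def] }
  obtain ⟨v, hv⟩ := (hf.comp ι).isTwoCoboundary_of_symm fun x y => sub_eq_zero.1 (hc _ _)
  replace hv (x y : R) :
      f ⟨x, 0, 0⟩ ⟨y, 0, 0⟩ = v (.ofAdd x) + v (.ofAdd y) - v (.ofAdd (x + y)) := hv _ _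
  -- Extending `v` to the whole group through the central coordinate makes the cocycle vanish on the
  -- centre.
  let e₂ (g h : Heisenberg R) : A := v (.ofAdd g.c) + v (.ofAdd h.c) - v (.ofAdd (g * h).c)
  have he₂ : IsTwoCoboundary e₂ := ⟨fun g => v (.ofAdd g.c), fun _ _ => rfl⟩
  obtain ⟨f₂, hf₂⟩ : ∃ f₂, f₂ = f - e₂ := ⟨_, rfl⟩
  have hf₂_zero (x y : R) : f₂ ⟨x, 0, 0⟩ ⟨y, 0, 0⟩ = 0 := by
    simp [hf₂, e₂, hv, mul_def]
  have hf₂_one (g : Heisenberg R) : f₂ 1 g = 0 := by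
    rw [hf₂, (hf.sub he₂.isTwoCocycle).map_one_left, ← hf₂]
    exact hf₂_zero 0 0
  -- The coboundary of this `u` cancels `f₂` on pairs of a central element and a representative `(0,
  -- b, a)`. The cocycle identity then makes `f₃` vanish whenever one argument is central, so that
  -- it depends only on cosets of the centre.
  let u (g : Heisenberg R) : A := f₂ ⟨g.c, 0, 0⟩ ⟨0, g.b, g.a⟩
  let e₃ (g h : Heisenberg R) : A := u g + u h - u (g * h)
  have he₃ : IsTwoCoboundary e₃ := ⟨u, fun _ _ => rfl⟩
  obtain ⟨f₃, hf₃⟩ : ∃ f₃, f₃ = f₂ + e₃ := ⟨_, rfl⟩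
  have hf₃' : IsTwoCocycle f₃ := by
    rw [hf₃, hf₂]
    exact (hf.sub he₂.isTwoCocycle).add he₃.isTwoCocycle
  have hsub : f₃ - f = -e₂ + e₃ := by
    rw [hf₃, hf₂]
    abel
  have hcob : IsTwoCoboundary (f₃ - f) := hsub ▸ he₂.neg.add he₃
  have hcomm (c : R) (g : Heisenberg R) :
      (⟨c, 0, 0⟩ : Heisenberg R) * g = g * ⟨c, 0, 0⟩ := by
    simp [mul_def, add_comm]
  have hc₃ (c : R) (g : Heisenberg R) : f₃ ⟨c, 0, 0⟩ g = f₃ g ⟨c, 0, 0⟩ := by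
    have h := hcob.commPairing_eq_zero (hcomm c g)
    rw [commPairing_sub, hc, sub_zero] at h
    exact sub_eq_zero.1 h
  have hs (c b a : R) : f₃ ⟨c, 0, 0⟩ ⟨0, b, a⟩ = 0 := by
    have h₁ : f₂ ⟨0, 0, 0⟩ ⟨0, b, a⟩ = 0 := hf₂_one _
    simp [hf₃, e₃, u, mul_def, hf₂_zero, h₁]
  have hcc (x y : R) : f₃ ⟨x, 0, 0⟩ ⟨y, 0, 0⟩ = 0 := by
    simp [hf₃, e₃, u, mul_def, hf₂_zero]
  have hz (c : R) (g : Heisenberg R) : f₃ ⟨c, 0, 0⟩ g = 0 := by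
    have h := hf₃' ⟨c, 0, 0⟩ ⟨g.c, 0, 0⟩ ⟨0, g.b, g.a⟩
    simpa [mul_def, hs, hcc] using h.symm
  have hleft (g h : Heisenberg R) : f₃ ⟨0, g.b, g.a⟩ h = f₃ g h := by
    have h := hf₃' ⟨g.c, 0, 0⟩ ⟨0, g.b, g.a⟩ h
    simpa [mul_def, hz] using h.symm
  have hright (g h : Heisenberg R) : f₃ g ⟨0, h.b, h.a⟩ = f₃ g h := by
    have h := hf₃' g ⟨0, h.b, h.a⟩ ⟨h.c, 0, 0⟩
    simpa [mul_def, ← hc₃, hz] using h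
  refine ⟨fun x y => f₃ ⟨0, x.toAdd.1, x.toAdd.2⟩ ⟨0, y.toAdd.1, y.toAdd.2⟩, fun x y z => ?_, ?_⟩
  · have h := hf₃' ⟨0, x.toAdd.1, x.toAdd.2⟩ ⟨0, y.toAdd.1, y.toAdd.2⟩ ⟨0, z.toAdd.1, z.toAdd.2⟩
    rw [← hleft (_ * _), ← hright _ (_ * _)] at h
    exact h
  · have h : (f - fun g h => f₃ ⟨0, g.b, g.a⟩ ⟨0, h.b, h.a⟩) = -(f₃ - f) := by
      funext g h
      simp only [Pi.sub_apply, Pi.neg_apply, hleft, hright]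
      abel
    exact h ▸ hcob.neg

theorem commPairing_leftCocycle_center [Invertible (2 : R)] (φ : R →+ A) (c : R)
    (g : Heisenberg R) : commPairing (leftCocycle φ) ⟨c, 0, 0⟩ g = φ (c * g.b) := by
  simp [commPairing, leftCocycle]

theorem commPairing_rightCocycle_center [Invertible (2 : R)] (ψ : R →+ A) (c : R)
    (g : Heisenberg R) : commPairing (rightCocycle ψ) ⟨c, 0, 0⟩ g = -ψ (g.a * c) := by
  simp [commPairing, rightCocycle]

/-- Every two-cocycle of the Heisenberg group becomes, up to left and right cocycles, orthogonal to
the centre. -/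
theorem exists_commPairing_center_eq_zero [Invertible (2 : R)] {f : Heisenberg R → Heisenberg R → A}
    (hf : IsTwoCocycle f) : ∃ φ ψ : R →+ A,
      ∀ c g, commPairing (f - (leftCocycle φ + rightCocycle ψ)) ⟨c, 0, 0⟩ g = 0 := by
  have hmul (x y : R) :
      (⟨x + y, 0, 0⟩ : Heisenberg R) = ⟨x, 0, 0⟩ * ⟨y, 0, 0⟩ := by simp [mul_def]
  have hcomm (c : R) (g : Heisenberg R) :
      (⟨c, 0, 0⟩ : Heisenberg R) * g = g * ⟨c, 0, 0⟩ := by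
    simp [mul_def, add_comm]
  refine ⟨.mk' (fun x => commPairing f ⟨x, 0, 0⟩ ⟨0, 1, 0⟩) fun x y => ?_,
    .mk' (fun x => commPairing f ⟨0, 0, 1⟩ ⟨x, 0, 0⟩) fun x y => ?_, fun c g => ?_⟩
  · rw [hmul, hf.commPairing_mul_left (hcomm _ _) (hcomm _ _)]
  · rw [hmul, hf.commPairing_mul_right (hcomm _ _).symm (hcomm _ _).symm]
  · have hg : g = ⟨g.c, 0, 0⟩ * (⟨0, g.b, 0⟩ * ⟨0, 0, g.a⟩) := by simp [mul_def]
    have hsum : commPairing f ⟨c, 0, 0⟩ g = commPairing f ⟨c, 0, 0⟩ ⟨0, g.b, 0⟩ -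
        commPairing f ⟨0, 0, g.a⟩ ⟨c, 0, 0⟩ := by
      conv_lhs => rw [hg]
      rw [hf.commPairing_mul_right (hcomm _ _) (hcomm _ _),
        hf.commPairing_mul_right (hcomm _ _) (hcomm _ _), commPairing_center_center hf, zero_add,
        commPairing_swap f ⟨c, 0, 0⟩ ⟨0, 0, g.a⟩, sub_eq_add_neg]
    have hadd (f₁ f₂ : Heisenberg R → Heisenberg R → A) (g h : Heisenberg R) :
        commPairing (f₁ + f₂) g h = commPairing f₁ g h + commPairing f₂ g h := by
      simp only [commPairing, Pi.add_apply]
      abel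
    rw [commPairing_sub, hadd, commPairing_leftCocycle_center, commPairing_rightCocycle_center,
      hsum, commPairing_center_b hf, commPairing_a_center hf]
    simp only [AddMonoidHom.mk'_apply]
    abel

/-- A two-cocycle inflated from the quotient by the centre is cohomologous to a biadditive one with
alternating components. -/
theorem exists_biadditive [Invertible (2 : R)] [DivisibleBy A ℤ]
    {F : Multiplicative (R × R) → Multiplicative (R × R) → A} (hF : IsTwoCocycle F) :
    ∃ ω₁ ω₂ β : R →+ R →+ A, (∀ x, ω₁ x x = 0) ∧ (∀ x, ω₂ x x = 0) ∧
      IsTwoCoboundary ((fun g h => F (toProd g) (toProd h)) - biadditiveCocycle ω₁ ω₂ β) := by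
  let η : Multiplicative (R × R) →* Multiplicative (R × R) :=
    (DistribSMul.toAddMonoidHom (R × R) (⅟2 : R)).toMultiplicative
  have hη (v) : η v * η v = v := by
    refine Multiplicative.toAdd.injective ?_
    change (⅟2 : R) • v.toAdd + (⅟2 : R) • v.toAdd = v.toAdd
    rw [← add_smul, invOf_two_add_invOf_two, one_smul]
  let K (v w : R × R) : A := commPairing F (η (.ofAdd v)) (.ofAdd w)
  have hKl (v v' w) : K (v + v') w = K v w + K v' w := by
    simp only [K, ofAdd_add, map_mul]
    exact hF.commPairing_mul_left (mul_comm _ _) (mul_comm _ _)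
  have hKr (v w w') : K v (w + w') = K v w + K v w' := by
    simp only [K, ofAdd_add]
    exact hF.commPairing_mul_right (mul_comm _ _) (mul_comm _ _)
  have hKs (v) : K v v = 0 := by
    have h₁ : commPairing F (η (.ofAdd v)) (η (.ofAdd v)) = 0 := sub_self _
    have h₂ := hF.commPairing_mul_right (g := η (.ofAdd v)) (h := η (.ofAdd v))
      (k := η (.ofAdd v)) rfl rfl
    rwa [hη, h₁, add_zero] at h₂
  have hKa (v w) : K v w = -K w v := by
    have h := hKs (v + w)
    rw [hKl, hKr, hKr, hKs, hKs, zero_add, add_zero] at h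
    exact eq_neg_of_add_eq_zero_left h
  let B (i j : R →+ R × R) : R →+ R →+ A :=
    .mk' (fun x => .mk' (fun y => K (i x) (j y)) fun y y' => by rw [map_add, hKr])
      fun x x' => by
        ext y
        simp only [AddMonoidHom.mk'_apply, AddMonoidHom.add_apply, map_add, hKl]
  let i₁ := AddMonoidHom.inl R R
  let i₂ := AddMonoidHom.inr R R
  have hB (i j x y) : B i j x y = K (i x) (j y) := rfl
  -- With `B = B i₂ i₁`, the mixed part of `K` is `B g.a h.b - B h.a g.b`. The coboundary of `g ↦ B
  -- g.a g.b` turns it into `2 B g.a h.b`, hence the doubled component.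
  refine ⟨B i₁ i₁, B i₂ i₂, B i₂ i₁ + B i₂ i₁, fun x => hKs _, fun x => hKs _, ?_⟩
  have h₁ := (hF.isTwoCoboundary_sub_half η hη).comp (toProd (R := R))
  have h₂ : IsTwoCoboundary fun g h : Heisenberg R =>
      B i₂ i₁ g.a g.b + B i₂ i₁ h.a h.b - B i₂ i₁ (g * h).a (g * h).b := ⟨_, fun _ _ => rfl⟩
  convert h₁.add h₂ using 1
  funext g h
  have h₃ : commPairing F (η (toProd g)) (toProd h) =
      K (i₁ g.b + i₂ g.a) (i₁ h.b + i₂ h.a) := by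
    simp [K, i₁, i₂, toProd]
  simp only [Pi.sub_apply, Pi.add_apply, biadditiveCocycle, h₃, hB, mul_def, hKl, hKr, map_add,
    AddMonoidHom.add_apply, hKa (i₁ g.b) (i₂ h.a)]
  abel

/-- Every two-cocycle of the Heisenberg group over a commutative ring in which two is invertible
is cohomologous to one in normal form. -/
theorem exists_normalForm [Invertible (2 : R)] [DivisibleBy A ℤ]
    {f : Heisenberg R → Heisenberg R → A} (hf : IsTwoCocycle f) :
    ∃ (φ ψ : R →+ A) (ω₁ ω₂ β : R →+ R →+ A), (∀ x, ω₁ x x = 0) ∧ (∀ x, ω₂ x x = 0) ∧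
      IsTwoCoboundary (f - (leftCocycle φ + rightCocycle ψ + biadditiveCocycle ω₁ ω₂ β)) := by
  obtain ⟨φ, ψ, h⟩ := exists_commPairing_center_eq_zero hf
  obtain ⟨F, hF, hfF⟩ := exists_inflation
    (hf.sub ((isTwoCocycle_leftCocycle φ).add (isTwoCocycle_rightCocycle ψ))) h
  obtain ⟨ω₁, ω₂, β, h₁, h₂, h₃⟩ := exists_biadditive hF
  refine ⟨φ, ψ, ω₁, ω₂, β, h₁, h₂, ?_⟩
  convert hfF.add h₃ using 1
  abel

/-- A two-cocycle in normal form is a coboundary only if all its components vanish, up to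
a multiple of the multiplication of the ring. -/
theorem normalForm_eq_zero [Invertible (2 : R)] {φ ψ : R →+ A} {ω₁ ω₂ β : R →+ R →+ A}
    (h₁ : ∀ x, ω₁ x x = 0) (h₂ : ∀ x, ω₂ x x = 0)
    (h : IsTwoCoboundary (leftCocycle φ + rightCocycle ψ + biadditiveCocycle ω₁ ω₂ β)) :
    φ = 0 ∧ ψ = 0 ∧ ω₁ = 0 ∧ ω₂ = 0 ∧ ∃ χ : R →+ A, ∀ a b, β a b = χ (a * b) := by
  have hφ : φ = 0 := by
    ext x
    have := h.commPairing_eq_zero (g := ⟨x, 0, 0⟩) (h := ⟨0, 1, 0⟩) (by simp [mul_def])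
    simpa [commPairing, leftCocycle, rightCocycle, biadditiveCocycle] using this
  have hψ : ψ = 0 := by
    ext x
    have := h.commPairing_eq_zero (g := ⟨0, 0, 1⟩) (h := ⟨x, 0, 0⟩) (by simp [mul_def])
    simpa [commPairing, leftCocycle, rightCocycle, biadditiveCocycle] using this
  have halt {ω : R →+ R →+ A} (hω : ∀ x, ω x x = 0) (hs : ∀ x y, ω x y - ω y x = 0) :
      ω = 0 := by
    have hanti (x y) : ω x y + ω y x = 0 := by
      have := hω (x + y)
      simp only [map_add, AddMonoidHom.add_apply, hω, zero_add, add_zero] at this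
      rwa [add_comm]
    ext x y
    -- A form both symmetric and alternating satisfies `2 ω = 0`. As `A` may have 2-torsion, the
    -- halving takes place in the argument.
    have h₁ := hs (⅟2 * x) y
    have h₂ := hanti (⅟2 * x) y
    have h₃ : ω x y = ω (⅟2 * x) y + ω (⅟2 * x) y := by
      rw [← AddMonoidHom.add_apply, ← map_add, ← add_mul, invOf_two_add_invOf_two, one_mul]
    simp only [AddMonoidHom.zero_apply]
    linear_combination (norm := abel) h₃ + h₁ + h₂
  have hω₁ : ω₁ = 0 := halt h₁ fun x y => by
    have := h.commPairing_eq_zero (g := ⟨0, x, 0⟩) (h := ⟨0, y, 0⟩) (by simp [mul_def, add_comm])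
    simpa [commPairing, leftCocycle, rightCocycle, biadditiveCocycle] using this
  have hω₂ : ω₂ = 0 := halt h₂ fun x y => by
    have := h.commPairing_eq_zero (g := ⟨0, 0, x⟩) (h := ⟨0, 0, y⟩) (by simp [mul_def, add_comm])
    simpa [commPairing, leftCocycle, rightCocycle, biadditiveCocycle] using this
  refine ⟨hφ, hψ, hω₁, hω₂, ?_⟩
  subst hφ hψ hω₁ hω₂
  obtain ⟨u, hu⟩ := h
  replace hu (g h : Heisenberg R) : β g.a h.b = u g + u h - u (g * h) := by
    rw [← hu]
    simp [leftCocycle, rightCocycle, biadditiveCocycle]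
  refine ⟨-AddMonoidHom.mk' (fun x => u ⟨x, 0, 0⟩) fun x y => ?_, fun a b => ?_⟩
  · have := hu ⟨x, 0, 0⟩ ⟨y, 0, 0⟩
    simp only [mul_def, map_zero, mul_zero, add_zero] at this
    linear_combination (norm := abel) this
  -- The two orders of multiplying `(0, 0, a)` and `(0, b, 0)` differ by the central element `a *
  -- b`, so `β a b` is minus the value of `u` there.
  · have e₁ := hu ⟨0, 0, a⟩ ⟨0, b, 0⟩
    have e₂ := hu ⟨0, b, 0⟩ ⟨0, 0, a⟩
    have e₃ := hu ⟨a * b, 0, 0⟩ ⟨0, b, a⟩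
    simp only [mul_def, map_zero, AddMonoidHom.zero_apply, mul_zero, zero_mul, add_zero,
      zero_add] at e₁ e₂ e₃
    simp only [AddMonoidHom.neg_apply, AddMonoidHom.mk'_apply]
    linear_combination (norm := abel) e₁ - e₂ - e₃

/-- The biadditive cocycle given by a multiple of the multiplication of the ring is
a coboundary. -/
theorem isTwoCoboundary_biadditiveCocycle_mul {β : R →+ R →+ A} (χ : R →+ A)
    (hχ : ∀ a b, β a b = χ (a * b)) : IsTwoCoboundary (biadditiveCocycle 0 0 β) := by
  refine ⟨fun g => -χ g.c, fun g h => ?_⟩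
  simp only [biadditiveCocycle, AddMonoidHom.zero_apply, hχ, mul_def, map_add]
  abel

end Cocycles

end Heisenberg

/-! ### Passage from explicit cocycles to group cohomology -/

section SchurMultiplier

/-- The additive group of two-cocycles with trivial action. -/
def twoCocycles (G A : Type*) [Group G] [AddCommGroup A] : AddSubgroup (G → G → A) where
  carrier := {f | IsTwoCocycle f}
  add_mem' := IsTwoCocycle.add
  zero_mem' := fun _ _ _ => rfl
  neg_mem' := IsTwoCocycle.neg

/-- The multiplicative group of the complex numbers, written additively. -/
abbrev ComplexUnits : Type u := ULift.{u} (Additive ℂˣ)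

theorem ComplexUnits.nsmul_surjective {n : ℕ} (hn : n ≠ 0) :
    Function.Surjective fun x : ComplexUnits.{u} => n • x := by
  rintro ⟨x⟩
  obtain ⟨z, hz⟩ := IsAlgClosed.exists_pow_nat_eq (x.toMul : ℂ) (Nat.pos_of_ne_zero hn)
  have hz₀ : z ≠ 0 := by
    rintro rfl
    rw [zero_pow hn] at hz
    exact x.toMul.ne_zero hz.symm
  refine ⟨⟨.ofMul (Units.mk0 z hz₀)⟩, ?_⟩
  refine ULift.ext _ _ (Additive.toMul.injective (Units.ext ?_))
  simpa using hz

noncomputable instance : DivisibleBy ComplexUnits.{u} ℤ :=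
  letI : DivisibleBy ComplexUnits.{u} ℕ :=
    divisibleByOfSMulRightSurj _ _ ComplexUnits.nsmul_surjective
  AddGroup.divisibleByIntOfDivisibleByNat _

/-- A two-cocycle with trivial action, as a two-cocycle in the sense of group cohomology. -/
def toCocycles₂ (G : Type u) [Group G] : twoCocycles G ComplexUnits.{u} →+
    groupCohomology.cocycles₂ (Rep.trivial (ULift.{u} ℤ) G ComplexUnits.{u}) where
  toFun f := ⟨fun x => f.1 x.1 x.2, (groupCohomology.mem_cocycles₂_iff _).2 f.2⟩
  map_zero' := rfl
  map_add' _ _ := rfl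

/-- The class in the Schur multiplier of a two-cocycle. -/
noncomputable def schurClass (G : Type u) [Group G] :
    twoCocycles G ComplexUnits.{u} →+ SchurMultiplier G :=
  (groupCohomology.H2π _).hom.toAddMonoidHom.comp (toCocycles₂ G)

theorem schurClass_surjective (G : Type u) [Group G] : Function.Surjective (schurClass G) := by
  intro x
  induction x using groupCohomology.H2_induction_on with
  | h f => exact ⟨⟨fun g h => f (g, h), (groupCohomology.mem_cocycles₂_iff _).1 f.2⟩, rfl⟩

theorem schurClass_eq_zero_iff {G : Type u} [Group G] (f : twoCocycles G ComplexUnits.{u}) :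
    schurClass G f = 0 ↔ IsTwoCoboundary f.1 := by
  refine (groupCohomology.H2π_eq_zero_iff (toCocycles₂ G f)).trans ⟨?_, ?_⟩
  · rintro ⟨u, hu⟩
    refine ⟨u, fun g h => (congrFun hu (g, h)).symm.trans ?_⟩
    rw [groupCohomology.d₁₂_hom_apply, Rep.trivial_ρ_apply]
    exact sub_add_eq_add_sub _ _ _ |>.trans (by rw [add_comm (u h)])
  · rintro ⟨u, hu⟩
    refine ⟨u, funext fun x => Eq.trans ?_ (hu x.1 x.2).symm⟩
    rw [groupCohomology.d₁₂_hom_apply, Rep.trivial_ρ_apply]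
    exact sub_add_eq_add_sub _ _ _ |>.trans (by rw [add_comm (u x.2)])

end SchurMultiplier

/-! ### Finite abelian groups and inversion of two -/

/-- The dual of a finite abelian group is isomorphic to it. -/
theorem nonempty_addMonoidHom_complexUnits_addEquiv (R : Type*) [AddCommGroup R] [Finite R] :
    Nonempty ((R →+ ComplexUnits.{u}) ≃+ R) := by
  obtain ⟨e⟩ := CommGroup.monoidHom_mulEquiv_of_hasEnoughRootsOfUnity (Multiplicative R) ℂ
  refine ⟨(AddEquiv.ulift.addMonoidHomCongrRight).trans
    { toFun := fun f => (e (AddMonoidHom.toMultiplicativeLeft f)).toAdd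
      invFun := fun x => AddMonoidHom.toMultiplicativeLeft.symm (e.symm (.ofAdd x))
      left_inv := fun f => by simp
      right_inv := fun x => by simp
      map_add' := fun f g => ?_ }⟩
  have : AddMonoidHom.toMultiplicativeLeft (f + g) =
      AddMonoidHom.toMultiplicativeLeft f * AddMonoidHom.toMultiplicativeLeft g := rfl
  rw [this, map_mul, toAdd_mul]

/-- A vector space over `ZMod p` is determined by its order. -/
theorem nonempty_linearEquiv_of_card {p n : ℕ} [Fact p.Prime] {M : Type*} [AddCommGroup M]
    [Module (ZMod p) M] (hM : Nat.card M = p ^ n) : Nonempty (M ≃ₗ[ZMod p] (Fin n → ZMod p)) := by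
  have hp : p.Prime := Fact.out
  have : Finite M := Nat.finite_of_card_ne_zero (by rw [hM]; exact pow_ne_zero _ hp.ne_zero)
  have h := Module.natCard_eq_pow_finrank (K := ZMod p) (V := M)
  rw [hM, Nat.card_zmod] at h
  exact ⟨LinearEquiv.ofFinrankEq _ _
    ((Nat.pow_right_injective hp.two_le h).symm.trans (Module.finrank_fin_fun _).symm)⟩

/-- An elementary abelian group is determined by its order. -/
theorem nonempty_addEquiv_of_card {p n : ℕ} [Fact p.Prime] {M : Type*} [AddCommGroup M]
    (hM : Nat.card M = p ^ n) (htors : ∀ x : M, p • x = 0) :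
    Nonempty (M ≃+ (Fin n → ZMod p)) :=
  letI : Module (ZMod p) M := AddCommGroup.zmodModule htors
  (nonempty_linearEquiv_of_card hM).map LinearEquiv.toAddEquiv

/-- Two is invertible in a ring of odd characteristic. -/
@[reducible]
def invertibleTwoOfOddCharP {R : Type*} [CommRing R] {n : ℕ} [CharP R n] (hn : Odd n) :
    Invertible (2 : R) :=
  invertibleOfRightInverse _ (((n + 1) / 2 : ℕ) : R) <| by
    have : 2 * ((n + 1) / 2) = n + 1 := by
      obtain ⟨k, rfl⟩ := hn
      lia
    simpa using congrArg (Nat.cast : ℕ → R) this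

/-! ### Computation of the multiplier over commutative rings -/

namespace Heisenberg

variable {R : Type u} [CommRing R]

/-- The group of alternating pairings of an abelian group. -/
def alternatingPairings (R A : Type*) [AddCommGroup R] [AddCommGroup A] :
    AddSubgroup (R →+ R →+ A) where
  carrier := {ω | ∀ x, ω x x = 0}
  add_mem' h h' x := by simp [h x, h' x]
  zero_mem' _ := rfl
  neg_mem' h x := by simp [h x]

/-- The components of a two-cocycle of the Heisenberg group in normal form. -/
abbrev NormalFormData (R A : Type*) [AddCommGroup R] [AddCommGroup A] : Type _ :=
  ((R →+ A) × (R →+ A)) × (alternatingPairings R A × alternatingPairings R A) × (R →+ R →+ A)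

/-- The two-cocycle in normal form with given components. -/
def normalForm (R A : Type*) [CommRing R] [Invertible (2 : R)] [AddCommGroup A] :
    NormalFormData R A →+ twoCocycles (Heisenberg R) A :=
  .mk' (fun d => ⟨leftCocycle d.1.1 + rightCocycle d.1.2 +
      biadditiveCocycle d.2.1.1.1 d.2.1.2.1 d.2.2,
    ((isTwoCocycle_leftCocycle _).add (isTwoCocycle_rightCocycle _)).add
      (isTwoCocycle_biadditiveCocycle _ _ _)⟩) fun d d' => by
    ext g h
    simp only [leftCocycle, rightCocycle, biadditiveCocycle, Prod.fst_add, Prod.snd_add,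
      AddSubgroup.coe_add, AddMonoidHom.add_apply, Pi.add_apply]
    abel

/-- The class in the Schur multiplier of the two-cocycle in normal form with given components. -/
noncomputable def normalFormClass (R : Type u) [CommRing R] [Invertible (2 : R)] :
    NormalFormData R ComplexUnits.{u} →+ SchurMultiplier (Heisenberg R) :=
  (schurClass (Heisenberg R)).comp (normalForm R ComplexUnits.{u})

theorem normalFormClass_surjective [Invertible (2 : R)] :
    Function.Surjective (normalFormClass R) := by
  intro x
  obtain ⟨f, rfl⟩ := schurClass_surjective _ x
  obtain ⟨φ, ψ, ω₁, ω₂, β, h₁, h₂, h⟩ := exists_normalForm f.2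
  refine ⟨((φ, ψ), (⟨ω₁, h₁⟩, ⟨ω₂, h₂⟩), β), ?_⟩
  rw [eq_comm, ← sub_eq_zero]
  change schurClass _ f - schurClass _ (normalForm _ _ _) = 0
  rw [← map_sub, schurClass_eq_zero_iff]
  exact h

/-- The components of the normal form that consist of a multiple of the multiplication. -/
def mulData (R A : Type*) [CommRing R] [AddCommGroup A] : (R →+ A) →+ NormalFormData R A :=
  .mk' (fun χ => (0, 0, (AddMonoidHom.compHom χ).comp AddMonoidHom.mul)) fun χ χ' => by
    refine Prod.ext (add_zero 0).symm (Prod.ext (add_zero 0).symm ?_)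
    ext x y
    rfl

theorem mulData_injective (A : Type*) [AddCommGroup A] : Function.Injective (mulData R A) := by
  intro χ χ' h
  ext x
  have := DFunLike.congr_fun (DFunLike.congr_fun (congrArg (fun d => d.2.2) h) x) 1
  change χ (x * 1) = χ' (x * 1) at this
  rwa [mul_one] at this

/-- Together with `normalFormClass_surjective` and `mulData_injective`, this presents the multiplier
as the quotient of the normal forms by a copy of the dual of `R`. -/
theorem ker_normalFormClass [Invertible (2 : R)] :
    (normalFormClass R).ker = (mulData R ComplexUnits.{u}).range := by
  ext d
  obtain ⟨⟨φ, ψ⟩, ⟨⟨ω₁, h₁⟩, ⟨ω₂, h₂⟩⟩, β⟩ := d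
  rw [AddMonoidHom.mem_ker, AddMonoidHom.mem_range]
  refine (schurClass_eq_zero_iff _).trans ⟨fun h => ?_, ?_⟩
  · obtain ⟨rfl, rfl, rfl, rfl, χ, hχ⟩ := normalForm_eq_zero h₁ h₂ h
    exact ⟨χ, Prod.ext rfl (Prod.ext rfl
      (AddMonoidHom.ext fun x => AddMonoidHom.ext fun y => (hχ x y).symm))⟩
  · rintro ⟨χ, hχ⟩
    rw [← hχ]
    convert isTwoCoboundary_biadditiveCocycle_mul (A := ComplexUnits.{u})
      (β := (AddMonoidHom.compHom χ).comp AddMonoidHom.mul) χ fun _ _ => rfl using 1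
    funext g h
    change (0 : ComplexUnits.{u}) + 0 + _ = _
    rw [add_zero, zero_add]
    rfl

/-- The Schur multiplier of the Heisenberg group over a finite commutative ring of odd order whose
additive group is cyclic. -/
theorem nonempty_schurMultiplier_addEquiv_of_cyclic [Invertible (2 : R)] [Finite R]
    (hR : Function.Surjective (Int.cast : ℤ → R)) :
    Nonempty (SchurMultiplier (Heisenberg R) ≃+ R × R) := by
  obtain ⟨e⟩ := nonempty_addMonoidHom_complexUnits_addEquiv.{u} R
  let i : (R →+ ComplexUnits.{u}) × (R →+ ComplexUnits.{u}) →+ NormalFormData R ComplexUnits.{u} :=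
    AddMonoidHom.inl _ _
  suffices h : Function.Bijective ((normalFormClass R).comp i) from
    ⟨(AddEquiv.ofBijective _ h).symm.trans (AddEquiv.mk' (e.toEquiv.prodCongr e.toEquiv)
      fun x y => Prod.ext (map_add e x.1 y.1) (map_add e x.2 y.2))⟩
  have hpair (β : R →+ R →+ ComplexUnits.{u}) (x y : R) : β x y = β 1 (x * y) := by
    obtain ⟨k, rfl⟩ := hR x
    rw [← zsmul_one k, map_zsmul, smul_mul_assoc, one_mul, map_zsmul]
    rfl
  -- On a cyclic group `β x y = β 1 (x * y)`, so every biadditive form is a multiple of the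
  -- multiplication and every alternating one is zero. Only `φ` and `ψ` survive.
  have hdecomp (d : NormalFormData R ComplexUnits.{u}) :
      d = i d.1 + mulData R _ (d.2.2 1) := by
    have halt (ω : alternatingPairings R ComplexUnits.{u}) : ω = 0 := by
      ext x y
      obtain ⟨k, hk⟩ := hR (x * y)
      rw [hpair, ← hk, ← zsmul_one k, map_zsmul, ω.2 1, smul_zero]
      rfl
    obtain ⟨d₁, ⟨ω₁, ω₂⟩, β⟩ := d
    refine Prod.ext (add_zero _).symm (Prod.ext ?_ ?_)
    · rw [halt ω₁, halt ω₂]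
      exact (add_zero _).symm
    · refine AddMonoidHom.ext fun x => AddMonoidHom.ext fun y => (hpair β x y).trans ?_
      exact (zero_add (β 1 (x * y))).symm
  have hker (χ) : normalFormClass R (mulData R _ χ) = 0 := by
    rw [← AddMonoidHom.mem_ker, ker_normalFormClass]
    exact ⟨χ, rfl⟩
  constructor
  · rw [injective_iff_map_eq_zero]
    intro d hd
    have : i d ∈ (normalFormClass R).ker := hd
    rw [ker_normalFormClass] at this
    obtain ⟨χ, hχ⟩ := this
    exact (congrArg Prod.fst hχ).symm
  · intro x
    obtain ⟨d, rfl⟩ := normalFormClass_surjective x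
    refine ⟨d.1, ?_⟩
    conv_rhs => rw [hdecomp d]
    rw [map_add, hker, add_zero]
    rfl

/-- The alternating pairings of an elementary abelian group of rank two are the homomorphisms
composed with the determinant. -/
theorem card_alternatingPairings {n : ℕ} {V A : Type*} [AddCommGroup V] [AddCommGroup A]
    (e : V ≃+ ZMod n × ZMod n) :
    Nat.card (alternatingPairings V A) = Nat.card (ZMod n →+ A) := by
  let det (χ : ZMod n →+ A) : alternatingPairings V A :=
    ⟨.mk' (fun x => .mk' (fun y => χ ((e x).1 * (e y).2 - (e x).2 * (e y).1)) fun y y' => by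
        rw [← map_add]
        congr 1
        simp only [map_add, Prod.fst_add, Prod.snd_add]
        ring) fun x x' => by
          ext y
          simp only [AddMonoidHom.mk'_apply, AddMonoidHom.add_apply]
          rw [← map_add]
          congr 1
          simp only [map_add, Prod.fst_add, Prod.snd_add]
          ring,
      fun x => by
        change χ _ = 0
        rw [mul_comm, sub_self, map_zero]⟩
  refine Nat.card_congr
    { toFun ω := .mk' (fun t => ω.1 (e.symm (t, 0)) (e.symm (0, 1))) fun s t => by
        rw [← AddMonoidHom.add_apply, ← map_add, ← map_add, Prod.mk_add_mk, add_zero]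
      invFun := det
      left_inv ω := ?_
      right_inv χ := ?_ }
  · obtain ⟨ω, hω⟩ := ω
    have hanti (x y) : ω x y = -ω y x := by
      have := hω (x + y)
      simp only [map_add, AddMonoidHom.add_apply, hω x, hω y, zero_add, add_zero] at this
      exact eq_neg_of_add_eq_zero_right this
    have hsmul (k : ℤ) (f : V →+ A) (x : V) : (k • f) x = k • f x := rfl
    have hint (k l : ℤ) : e.symm ((k : ZMod n), (l : ZMod n)) =
        k • e.symm (1, 0) + l • e.symm (0, 1) := by
      rw [← map_zsmul, ← map_zsmul, ← map_add]
      simp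
    refine Subtype.ext (AddMonoidHom.ext fun x => AddMonoidHom.ext fun y => ?_)
    obtain ⟨⟨x₁, x₂⟩, rfl⟩ := e.symm.surjective x
    obtain ⟨⟨y₁, y₂⟩, rfl⟩ := e.symm.surjective y
    -- `A` is only a `ℤ`-module, so the coordinates are lifted to integers before expanding `ω` on
    -- the basis.
    obtain ⟨k, rfl⟩ := ZMod.intCast_surjective x₁
    obtain ⟨l, rfl⟩ := ZMod.intCast_surjective x₂
    obtain ⟨m, rfl⟩ := ZMod.intCast_surjective y₁
    obtain ⟨r, rfl⟩ := ZMod.intCast_surjective y₂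
    have h := hint (k * r - l * m) 0
    simp only [Int.cast_zero, zero_smul, add_zero, Int.cast_sub, Int.cast_mul] at h
    simp only [det, AddMonoidHom.mk'_apply, AddEquiv.apply_symm_apply]
    simp only [h, hint, map_add, map_zsmul,
      AddMonoidHom.add_apply, hsmul, hω (e.symm _), hanti (e.symm (0, 1)) (e.symm (1, 0))]
    module
  · ext t
    simp [det]

/-- The Schur multiplier of the Heisenberg group over a commutative ring of order `p ^ 2` and odd
prime characteristic `p`. -/
theorem nonempty_schurMultiplier_addEquiv_of_charP {p : ℕ} [Fact p.Prime] (hp : Odd p) [CharP R p]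
    (hR : Nat.card R = p ^ 2) :
    Nonempty (SchurMultiplier (Heisenberg R) ≃+ (Fin 8 → ZMod p)) := by
  have hp₀ : p.Prime := Fact.out
  let : Algebra (ZMod p) R := ZMod.algebra R p
  let : Invertible (2 : R) := invertibleTwoOfOddCharP hp
  have : Finite R := Nat.finite_of_card_ne_zero (by rw [hR]; exact pow_ne_zero _ hp₀.ne_zero)
  have hrank : Module.finrank (ZMod p) R = 2 := by
    have h := Module.natCard_eq_pow_finrank (K := ZMod p) (V := R)
    rw [hR, Nat.card_zmod] at h
    exact (Nat.pow_right_injective hp₀.two_le h).symm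
  let e : R ≃ₗ[ZMod p] ZMod p × ZMod p := LinearEquiv.ofFinrankEq _ _ (by simp [hrank])
  obtain ⟨dual⟩ := nonempty_addMonoidHom_complexUnits_addEquiv.{u} R
  have hdual : Nat.card (R →+ ComplexUnits.{u}) = p ^ 2 := by
    rw [Nat.card_congr dual.toEquiv, hR]
  have halt : Nat.card (alternatingPairings R ComplexUnits.{u}) = p := by
    obtain ⟨d⟩ := nonempty_addMonoidHom_complexUnits_addEquiv.{u} (ZMod p)
    rw [card_alternatingPairings e.toAddEquiv, Nat.card_congr d.toEquiv, Nat.card_zmod]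
  -- Identifying the dual with `R` turns pairings into `ZMod p`-linear endomorphisms of a plane.
  have hbil : Nat.card (R →+ R →+ ComplexUnits.{u}) = p ^ 4 := by
    rw [Nat.card_congr (dual.addMonoidHomCongrRight.trans
      (AddMonoidHom.toZModLinearMapEquiv (M := R) (M₁ := R) p)).toEquiv,
      Module.natCard_eq_pow_finrank (K := ZMod p), Module.finrank_linearMap, hrank, Nat.card_zmod]
  have hdata : Nat.card (NormalFormData R ComplexUnits.{u}) = p ^ 10 := by
    rw [Nat.card_prod, Nat.card_prod, Nat.card_prod, Nat.card_prod, hdual, halt, hbil]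
    ring
  have hker : Nat.card (normalFormClass R).ker = p ^ 2 := by
    rw [ker_normalFormClass, ← hdual]
    exact (Nat.card_congr (AddMonoidHom.ofInjective
      (mulData_injective (R := R) ComplexUnits.{u})).toEquiv).symm
  have hcard : Nat.card (SchurMultiplier (Heisenberg R)) = p ^ 8 := by
    have h := AddSubgroup.card_eq_card_quotient_mul_card_addSubgroup (normalFormClass R).ker
    rw [hdata, hker, Nat.card_congr (QuotientAddGroup.quotientKerEquivOfSurjective
      (normalFormClass R) normalFormClass_surjective).toEquiv] at h
    refine Nat.eq_of_mul_eq_mul_right (pow_pos hp₀.pos 2) (h.symm.trans ?_)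
    ring
  have htors {M : Type u} [AddCommGroup M] (f : R →+ M) : p • f = 0 := by
    ext x
    rw [AddMonoidHom.coe_smul, Pi.smul_apply, ← map_nsmul, nsmul_eq_mul, CharP.cast_eq_zero,
      zero_mul, map_zero]
    rfl
  have htors' (x : SchurMultiplier (Heisenberg R)) : p • x = 0 := by
    obtain ⟨d, rfl⟩ := normalFormClass_surjective x
    have hd : p • d = 0 := Prod.ext (Prod.ext (htors _) (htors _))
      (Prod.ext (Prod.ext (Subtype.ext (htors _)) (Subtype.ext (htors _))) (htors _))
    rw [← map_nsmul, hd, map_zero]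
  exact nonempty_addEquiv_of_card hcard htors'

end Heisenberg

/-! ### Classification of the rings of order `p ^ 2` -/

section Rings

variable {p : ℕ} [Fact p.Prime] {R : Type u} [Ring R]

theorem natCard_truncatedPolynomialRing (p : ℕ) [Fact p.Prime] :
    Nat.card (TruncatedPolynomialRing p) = p ^ 2 := by
  have hX : ((Polynomial.X : Polynomial (ZMod p)) ^ 2).Monic := Polynomial.monic_X_pow 2
  let b := AdjoinRoot.powerBasis' hX
  have : Module.Finite (ZMod p) (AdjoinRoot ((Polynomial.X : Polynomial (ZMod p)) ^ 2)) :=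
    b.finite
  have h := Module.natCard_eq_pow_finrank (K := ZMod p)
    (V := AdjoinRoot ((Polynomial.X : Polynomial (ZMod p)) ^ 2))
  rw [b.finrank, AdjoinRoot.powerBasis'_dim, Polynomial.natDegree_X_pow, Nat.card_zmod] at h
  exact h

instance charP_truncatedPolynomialRing : CharP (TruncatedPolynomialRing p) p := by
  have : Nontrivial (TruncatedPolynomialRing p) := by
    have : Finite (TruncatedPolynomialRing p) := Nat.finite_of_card_ne_zero (by
      rw [natCard_truncatedPolynomialRing]
      exact pow_ne_zero _ (Fact.out : p.Prime).ne_zero)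
    rw [← Finite.one_lt_card_iff_nontrivial, natCard_truncatedPolynomialRing]
    exact Nat.one_lt_pow two_ne_zero (Fact.out : p.Prime).one_lt
  exact charP_of_injective_algebraMap (algebraMap (ZMod p) (TruncatedPolynomialRing p)).injective p

/-- A ring whose characteristic is its order is the ring of integers modulo that order. -/
theorem nonempty_ringEquiv_zmod {n : ℕ} [NeZero n] [CharP R n] (hR : Nat.card R = n) :
    Nonempty (R ≃+* ZMod n) := by
  have : Finite R := Nat.finite_of_card_ne_zero (by rw [hR]; exact NeZero.ne n)
  exact ⟨(RingEquiv.ofBijective (ZMod.castHom dvd_rfl R) <|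
    (Nat.bijective_iff_injective_and_card _).2
      ⟨ZMod.castHom_injective R, by rw [hR, Nat.card_zmod]⟩).symm⟩

/-- A ring of order `p ^ 2` and characteristic `p` without zero divisors is the
field of order `p ^ 2`. -/
theorem nonempty_ringEquiv_galoisField [CharP R p] [NoZeroDivisors R] (hR : Nat.card R = p ^ 2) :
    Nonempty (R ≃+* GaloisField p 2) := by
  have : Finite R := Nat.finite_of_card_ne_zero (by
    rw [hR]; exact pow_ne_zero _ (Fact.out : p.Prime).ne_zero)
  have : Nontrivial R := CharP.nontrivial_of_char_ne_one (Fact.out : p.Prime).ne_one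
  have : IsDomain R := NoZeroDivisors.to_isDomain R
  -- Commutativity comes from Wedderburn's little theorem.
  let : Field R := (Finite.isDomain_to_isField R).toField
  let : Fintype R := Fintype.ofFinite R
  let : Fintype (GaloisField p 2) := Fintype.ofFinite _
  refine ⟨FiniteField.ringEquivOfCardEq ?_⟩
  rw [← Nat.card_eq_fintype_card, ← Nat.card_eq_fintype_card, hR, GaloisField.card p 2 two_ne_zero]

/-- A ring of order `p ^ 2` and characteristic `p` with zero divisors is
`𝔽_p[t]/(t²)` or `𝔽_p × 𝔽_p`. -/
theorem nonempty_ringEquiv_of_zeroDivisor [CharP R p] (hR : Nat.card R = p ^ 2) {x y : R}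
    (hxy : x * y = 0) (hx : x ≠ 0) (hy : y ≠ 0) :
    Nonempty (R ≃+* TruncatedPolynomialRing p) ∨ Nonempty (R ≃+* ZMod p × ZMod p) := by
  have hp : p.Prime := Fact.out
  let : Algebra (ZMod p) R := ZMod.algebra R p
  have hfinite : Finite R := Nat.finite_of_card_ne_zero (by rw [hR]; exact pow_ne_zero _ hp.ne_zero)
  have hnt : Nontrivial R := CharP.nontrivial_of_char_ne_one hp.ne_one
  -- A nonzero scalar is not a zero divisor. Hence `1` and `x` are independent and, by counting,
  -- form a basis of `R`.
  have hscalar (c : ZMod p) : x ≠ algebraMap _ R c := by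
    rintro rfl
    rw [← Algebra.smul_def, smul_eq_zero] at hxy
    exact hxy.elim (fun h => hx (by rw [h, map_zero])) hy
  have hinj : Function.Injective fun c : ZMod p × ZMod p => algebraMap _ R c.1 + c.2 • x := by
    rintro ⟨a, b⟩ ⟨a', b'⟩ h
    have h' : (b - b') • x = algebraMap _ R (a' - a) := by
      rw [sub_smul, map_sub, sub_eq_sub_iff_add_eq_add, add_comm, add_comm (algebraMap _ R a')]
      simpa [add_comm] using h
    have hb : b = b' := by
      by_contra hb
      refine hscalar ((b - b')⁻¹ * (a' - a)) ?_
      rw [map_mul, ← h', ← Algebra.smul_def, inv_smul_smul₀ (sub_ne_zero.2 hb)]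
    subst hb
    exact Prod.ext ((algebraMap (ZMod p) R).injective (add_right_cancel h)) rfl
  have hspan (z : R) : ∃ a b : ZMod p, z = algebraMap _ R a + b • x := by
    have hbij := (Nat.bijective_iff_injective_and_card _).2 ⟨hinj, by
      rw [Nat.card_prod, Nat.card_zmod, hR, sq]⟩
    obtain ⟨⟨a, b⟩, h⟩ := hbij.2 z
    exact ⟨a, b, h.symm⟩
  -- Writing `y = a + b x`, the relation `x * y = 0` reads `a x + b x² = 0`, and `b ≠ 0` because `y
  -- ≠ 0`. If `γ = 0` then `x` plays the role of `t`; otherwise `γ⁻¹ x` is an idempotent that splits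
  -- `R`.
  obtain ⟨γ, hγ⟩ : ∃ γ : ZMod p, x * x = γ • x := by
    obtain ⟨a, b, rfl⟩ := hspan y
    rw [mul_add, ← Algebra.commutes, ← Algebra.smul_def, mul_smul_comm] at hxy
    have hb : b ≠ 0 := by
      rintro rfl
      rw [zero_smul, add_zero, smul_eq_zero_iff_left hx] at hxy
      exact hy (by rw [hxy, map_zero, zero_smul, add_zero])
    refine ⟨-(b⁻¹ * a), ?_⟩
    rw [neg_smul, mul_smul, ← smul_neg, eq_neg_of_add_eq_zero_left hxy, neg_neg,
      inv_smul_smul₀ hb]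
  rcases eq_or_ne γ 0 with rfl | hγ₀
  · left
    let φ : TruncatedPolynomialRing p →+* R := Ideal.Quotient.lift _
      (Polynomial.aeval x : Polynomial (ZMod p) →ₐ[ZMod p] R).toRingHom fun q hq => by
        obtain ⟨r, rfl⟩ := Ideal.mem_span_singleton.1 hq
        change Polynomial.aeval x (Polynomial.X ^ 2 * r) = 0
        rw [map_mul, map_pow, Polynomial.aeval_X, sq, hγ, zero_smul, zero_mul]
    have hφ : Function.Surjective φ := fun z => by
      obtain ⟨a, b, rfl⟩ := hspan z
      refine ⟨Ideal.Quotient.mk _ (Polynomial.C a + b • Polynomial.X), ?_⟩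
      change Polynomial.aeval x (Polynomial.C a + b • Polynomial.X) = _
      rw [map_add, Polynomial.aeval_C, map_smul, Polynomial.aeval_X]
    have hcard := natCard_truncatedPolynomialRing p
    have : Finite (TruncatedPolynomialRing p) :=
      Nat.finite_of_card_ne_zero (by rw [hcard]; exact pow_ne_zero _ hp.ne_zero)
    exact ⟨(RingEquiv.ofBijective φ <|
      (Nat.bijective_iff_surjective_and_card _).2 ⟨hφ, by rw [hR, hcard]⟩).symm⟩
  · right
    obtain ⟨e, he⟩ : ∃ e, e = γ⁻¹ • x := ⟨_, rfl⟩
    have hee : e * e = e := by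
      rw [he, smul_mul_smul_comm, hγ, smul_smul, mul_assoc, inv_mul_cancel₀ hγ₀, mul_one]
    have hxe : x = γ • e := by rw [he, smul_inv_smul₀ hγ₀]
    let φ : ZMod p × ZMod p →+* R :=
      { toFun := fun c => c.1 • e + c.2 • (1 - e)
        map_one' := by simp
        map_zero' := by simp
        map_add' := fun c d => by
          simp only [Prod.fst_add, Prod.snd_add, add_smul]
          abel
        map_mul' := fun c d => by
          simp [mul_add, add_mul, mul_sub, sub_mul, hee, smul_smul, mul_comm] }
    have hφ : Function.Surjective φ := fun z => by
      obtain ⟨a, b, rfl⟩ := hspan z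
      refine ⟨(a + b * γ, a), ?_⟩
      change (a + b * γ) • e + a • (1 - e) = _
      rw [hxe, Algebra.algebraMap_eq_smul_one]
      module
    exact ⟨(RingEquiv.ofBijective φ <| (Nat.bijective_iff_surjective_and_card _).2
      ⟨hφ, by rw [hR, Nat.card_prod, Nat.card_zmod, sq]⟩).symm⟩

/-- The classification of the rings of order `p ^ 2`. -/
theorem ring_of_card_prime_sq (hR : Nat.card R = p ^ 2) :
    Nonempty (R ≃+* TruncatedPolynomialRing p) ∨ Nonempty (R ≃+* GaloisField p 2) ∨
      Nonempty (R ≃+* ZMod p × ZMod p) ∨ Nonempty (R ≃+* ZMod (p ^ 2)) := by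
  have hp : p.Prime := Fact.out
  have : Finite R := Nat.finite_of_card_ne_zero (by rw [hR]; exact pow_ne_zero _ hp.ne_zero)
  have : Nontrivial R := by
    rw [← Finite.one_lt_card_iff_nontrivial, hR]
    exact Nat.one_lt_pow two_ne_zero hp.one_lt
  obtain ⟨n, hn⟩ := CharP.exists R
  have hdvd : n ∣ p ^ 2 := by
    rw [← CharP.cast_eq_zero_iff R, ← hR, ← nsmul_one, card_nsmul_eq_zero']
  obtain ⟨k, hk, rfl⟩ := (Nat.dvd_prime_pow hp).1 hdvd
  interval_cases k
  · exact absurd (pow_zero p) (CharP.char_ne_one R (p ^ 0))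
  · rw [pow_one] at hn
    by_cases h : NoZeroDivisors R
    · exact .inr (.inl (nonempty_ringEquiv_galoisField hR))
    · obtain ⟨x, y, hxy, hx, hy⟩ : ∃ x y : R, x * y = 0 ∧ x ≠ 0 ∧ y ≠ 0 := by
        by_contra! hcon
        exact h ⟨fun {x y} hxy => or_iff_not_imp_left.2 (hcon x y hxy)⟩
      rcases nonempty_ringEquiv_of_zeroDivisor hR hxy hx hy with h | h
      · exact .inl h
      · exact .inr (.inr (.inl h))
  · have : NeZero (p ^ 2) := ⟨pow_ne_zero _ hp.ne_zero⟩
    exact .inr (.inr (.inr (nonempty_ringEquiv_zmod hR)))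

end Rings

/-! ### Transfer along ring isomorphisms and the main theorem -/

/-- The Schur multiplier of the Heisenberg group over a ring of order `p ^ 2` that is isomorphic to
a commutative ring of characteristic `p`. -/
theorem nonempty_schurMultiplier_addEquiv_of_ringEquiv {p : ℕ} [Fact p.Prime] (hp : Odd p)
    {R : Type u} [Ring R] (hR : Nat.card R = p ^ 2) {S : Type*} [CommRing S] [CharP S p]
    (e : R ≃+* S) : Nonempty (SchurMultiplier (Heisenberg R) ≃+ (Fin 8 → ZMod p)) := by
  let : CommRing R :=
    { ‹Ring R› with mul_comm := fun x y => e.injective (by rw [map_mul, map_mul, mul_comm]) }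
  have : CharP R p := (RingHom.charP_iff (e : R →+* S) e.injective p).2 inferInstance
  exact Heisenberg.nonempty_schurMultiplier_addEquiv_of_charP hp hR

/-- The Schur multiplier of the Heisenberg group over the ring of integers modulo an odd number. -/
theorem nonempty_schurMultiplier_addEquiv_of_zmod {n : ℕ} [NeZero n] (hn : Odd n)
    {R : Type u} [Ring R] (e : R ≃+* ZMod n) :
    Nonempty (SchurMultiplier (Heisenberg R) ≃+ (Fin 2 → ZMod n)) := by
  let : CommRing R :=
    { ‹Ring R› with mul_comm := fun x y => e.injective (by rw [map_mul, map_mul, mul_comm]) }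
  have hfinite : Finite R := .of_equiv _ e.symm.toEquiv
  have : CharP R n := (RingHom.charP_iff (e : R →+* ZMod n) e.injective n).2 inferInstance
  let : Invertible (2 : R) := invertibleTwoOfOddCharP hn
  obtain ⟨f⟩ := Heisenberg.nonempty_schurMultiplier_addEquiv_of_cyclic (R := R) fun x => by
    obtain ⟨k, hk⟩ := ZMod.intCast_surjective (e x)
    exact ⟨k, e.injective (by rw [map_intCast, hk])⟩
  exact ⟨f.trans ((e.toAddEquiv.prodCongr e.toAddEquiv).trans
    (LinearEquiv.finTwoArrow (ZMod n) (ZMod n)).symm.toAddEquiv)⟩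

theorem theorem1p1 (p : ℕ) [Fact p.Prime] (hp : Odd p) (R : Type u) [Ring R]
    (hR : Nat.card R = p ^ 2) :
    (Nonempty (R ≃+* TruncatedPolynomialRing p) ∨ Nonempty (R ≃+* GaloisField p 2) ∨
      Nonempty (R ≃+* ZMod p × ZMod p) ∨ Nonempty (R ≃+* ZMod (p ^ 2))) ∧
    (Nonempty (R ≃+* TruncatedPolynomialRing p) →
      Nonempty (SchurMultiplier (Heisenberg R) ≃+ (Fin 8 → ZMod p))) ∧
    (Nonempty (R ≃+* GaloisField p 2) →
      Nonempty (SchurMultiplier (Heisenberg R) ≃+ (Fin 8 → ZMod p))) ∧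
    (Nonempty (R ≃+* ZMod p × ZMod p) →
      Nonempty (SchurMultiplier (Heisenberg R) ≃+ (Fin 8 → ZMod p))) ∧
    (Nonempty (R ≃+* ZMod (p ^ 2)) →
      Nonempty (SchurMultiplier (Heisenberg R) ≃+ (Fin 2 → ZMod (p ^ 2)))) := by
  have : NeZero (p ^ 2) := ⟨pow_ne_zero _ (Fact.out : p.Prime).ne_zero⟩
  have : CharP (ZMod p × ZMod p) p :=
    charP_of_injective_algebraMap (algebraMap (ZMod p) (ZMod p × ZMod p)).injective p
  exact ⟨ring_of_card_prime_sq hR,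
    fun ⟨e⟩ => nonempty_schurMultiplier_addEquiv_of_ringEquiv hp hR e,
    fun ⟨e⟩ => nonempty_schurMultiplier_addEquiv_of_ringEquiv hp hR e,
    fun ⟨e⟩ => nonempty_schurMultiplier_addEquiv_of_ringEquiv hp hR e,
    fun ⟨e⟩ => nonempty_schurMultiplier_addEquiv_of_zmod hp.pow e⟩
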